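/- Let $K,L,I,J$ be non-empty finite sets, let $G^{k\ell}\colon I\times J\to\mathbb R$ for $(k,\ell)\in K\times L$, and write $\Delta(X)$ for the set of probabilities over a finite set $X$. A strategy of player 1 is a map $\hat s\colon K\times\mathcal H\to\Delta(I)$ and a strategy of player 2 is a map $\hat t\colon L\times\mathcal H\to\Delta(J)$, where $\mathcal H=\bigcup_{m\ge 0}(I\times J)^m$ is the set of finite histories. For $\pi\in\Delta(K\times L)$, let $\mathbb E^{\pi}_{\hat s,\hat t}$ be the expectation for the probability induced on $K\times L\times(I\times J)^{\infty}$ when $(k,\ell)$ is drawn according to $\pi$, and then at each stage $m\ge1$, given the past history $h$, the actions $i_m$ and $j_m$ are drawn independently according to $\hat s(k,h)$ and $\hat t(\ell,h)$. For an evaluation $\theta=(\theta_m)_{m\ge 1}$ (that is, $\theta_m\ge 0$ and $\sum_{m\ge1}\theta_m=1$), $x\in\mathbb R^K$ and $q\in\Delta(L)$, the dual game is the zero-sum game in which player 1 (the maximizer) chooses $p\in\Delta(K)$ and a strategy $\hat s$, player 2 chooses a strategy $\hat t$, and the payoff is $$\mathbb E^{p\otimes q}_{\hat s,\hat t}\Big[\sum_{m\ge1}\theta_m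 G^{k\ell}(i_m,j_m)\Big]-\langle p,x\rangle .$$ **Statement.** For every evaluation $\theta$, every $x\in\mathbb R^K$ and every $q\in\Delta(L)$, the dual game has a value $w_\theta(x,q)$, that is, its maxmin ($\sup\inf$) and its minmax ($\inf\sup$) are equal. If moreover $\theta_1<1$ and $\theta^+_m:=\theta_{m+1}/(1-\theta_1)$ for $m\ge1$, then $$w_\theta(x,q)=(1-\theta_1)\min_{\tau\in\Delta(J)^L}\ \min_{\substack{(x_{ij})\in(\mathbb R^K)^{I\times J}\\ \forall i,\ \sum_j\bar\tau(j)x_{ij}=\frac{x-\theta_1G^q_{i\tau}}{1-\theta_1}}}\ \max_{i\in I}\ \sum_{j\in J}\bar\tau(j)\,w_{\theta^+}(x_{ij},q_j),$$ where both minima are attained (the inner one for every $\tau$). Here $\bar\tau(j)=\sum_{\ell}q^\ell\tau^\ell(j)$; $q_j\in\Delta(L)$ is given by $q_j^\ell=q^\ell\tau^\ell(j)/\bar\tau(j)$ if $\bar\tau(j)>0$, and is arbitrary if $\bar\tau(j)=0$; and $G^q_{i\tau}\in\mathbb R^K$ is the vector with coordinates $G^{k,q}_{i\tau}=\sum_{\ell,j}q^\ell\tau^\ell(j)G^{k\ell}(i,j)$.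 -/

import Mathlib

open MeasureTheory ProbabilityTheory

noncomputable section

namespace RepeatedGame

/-- `Δ(X)`: the set of probabilities over a finite set `X`, as the canonical simplex of `ℝ^X`. -/
abbrev Simplex (X : Type*) [Fintype X] : Type _ := ↥(stdSimplex ℝ X)

/-- The measure on `X` that gives mass `a x` to each point `x`. -/
def Simplex.toMeasure {X : Type*} [Fintype X] [MeasurableSpace X] (a : Simplex X) : Measure X :=
  ∑ x, ENNReal.ofReal (a.1 x) • Measure.dirac x

instance Simplex.isProbabilityMeasure {X : Type*} [Fintype X] [MeasurableSpace X]
    (a : Simplex X) : IsProbabilityMeasure a.toMeasure := by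
  constructor
  have h : ∑ x, ENNReal.ofReal (a.1 x) = 1 := by
    rw [← ENNReal.ofReal_sum_of_nonneg (fun x _ => a.2.1 x), a.2.2, ENNReal.ofReal_one]
  simpa [Simplex.toMeasure] using h

/-- Evaluations `θ ∈ Δ(ℕ*)`. Stages are indexed from `0`: `θ m` is the weight of the
`(m+1)`-th stage, so `θ 0` is the weight `θ₁` of the first stage. -/
structure IsEvaluation (θ : ℕ → ℝ) : Prop where
  nonneg : ∀ m, 0 ≤ θ m
  hasSum : HasSum θ 1

/-- The normalized evaluation `θ⁺` of the stages after the first one, `θ⁺ₘ = θₘ₊₁ / (1 - θ₁)`. -/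
def nextEval (θ : ℕ → ℝ) : ℕ → ℝ := fun m => θ (m + 1) / (1 - θ 0)

/-- Behaviour strategies of one type of a player with action set `A`: a mixed action after each
finite history of pairs of actions (oldest pair first). A strategy of player 1 in the repeated
game is a function `K → Strategy I J I`, one of player 2 a function `L → Strategy I J J`. -/
abbrev Strategy (I J A : Type*) [Fintype A] : Type _ := List (I × J) → Simplex A

section Play

variable {I J : Type*} [Fintype I] [Fintype J] [MeasurableSpace I] [MeasurableSpace J]

/-- The pairs of actions of stages `0, …, n`, as a history. -/
def historyOf (n : ℕ) (ω : (m : Finset.Iic n) → I × J) : List (I × J) :=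
  List.ofFn fun m : Fin (n + 1) =>
    ω ⟨(m : ℕ), Finset.mem_Iic.2 (Nat.lt_succ_iff.1 m.isLt)⟩

/-- The law of the pair of actions played after the history `h`: the players choose their
actions independently. -/
def stageLaw (s : Strategy I J I) (t : Strategy I J J) (h : List (I × J)) : Measure (I × J) :=
  (s h).toMeasure.prod (t h).toMeasure

instance stageLaw.isProbabilityMeasure (s : Strategy I J I) (t : Strategy I J J)
    (h : List (I × J)) : IsProbabilityMeasure (stageLaw s t h) := by
  unfold stageLaw
  infer_instance

variable [DiscreteMeasurableSpace I] [DiscreteMeasurableSpace J]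

/-- The law of the pair of actions of stage `n + 1`, given those of stages `0, …, n`. -/
def stageKernel (s : Strategy I J I) (t : Strategy I J J) (n : ℕ) :
    Kernel ((m : Finset.Iic n) → I × J) (I × J) where
  toFun ω := stageLaw s t (historyOf n ω)
  measurable' := measurable_of_countable _

instance stageKernel.isMarkovKernel (s : Strategy I J I) (t : Strategy I J J) (n : ℕ) :
    IsMarkovKernel (stageKernel s t n) :=
  ⟨fun ω => stageLaw.isProbabilityMeasure s t (historyOf n ω)⟩

/-- The probability on infinite plays `(I × J)^∞` induced by the strategies `s` and `t`
(Ionescu-Tulcea theorem). -/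
def playMeasure (s : Strategy I J I) (t : Strategy I J J) : Measure (ℕ → I × J) :=
  Kernel.trajMeasure (X := fun _ => I × J) (stageLaw s t []) (stageKernel s t)

end Play

section Game

variable {K L I J : Type*} [Fintype K] [Fintype L] [Fintype I] [Fintype J]
  [MeasurableSpace I] [MeasurableSpace J] [DiscreteMeasurableSpace I] [DiscreteMeasurableSpace J]

/-- The payoff `γ_θ(π, ŝ, t̂)`, i.e. the expectation of `∑ₘ θₘ G^{kℓ}(iₘ, jₘ)` when `(k, ℓ)` is
drawn according to `π` and the players then use `ŝ k` and `t̂ ℓ`. -/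
def payoff (G : K → L → I → J → ℝ) (θ : ℕ → ℝ) (π : Simplex (K × L))
    (s : K → Strategy I J I) (t : L → Strategy I J J) : ℝ :=
  ∑ k, ∑ l, π.1 (k, l) *
    ∫ ω, ∑' m, θ m * G k l (ω m).1 (ω m).2 ∂(playMeasure (s k) (t l))

/-- `p ⊗ Q`, for `p ∈ Δ(K)` and a transition probability `Q` from `K` to `L`. -/
def joint (p : Simplex K) (Q : K → Simplex L) : Simplex (K × L) :=
  ⟨fun kl => p.1 kl.1 * (Q kl.1).1 kl.2,
    fun kl => mul_nonneg (p.2.1 kl.1) ((Q kl.1).2.1 kl.2), by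
      rw [Fintype.sum_prod_type]
      have h : ∀ k, ∑ l, p.1 k * (Q k).1 l = p.1 k := fun k => by
        rw [← Finset.mul_sum, (Q k).2.2, mul_one]
      simp only [h]
      exact p.2.2⟩

/-- The payoff of the dual game `D[G_θ](x, Q)`, where player 1 also chooses `p ∈ Δ(K)`:
`γ_θ(p ⊗ Q, ŝ, t̂) - ⟨p, x⟩`. -/
def dualPayoff (G : K → L → I → J → ℝ) (θ : ℕ → ℝ) (x : K → ℝ) (Q : K → Simplex L)
    (a : Simplex K × (K → Strategy I J I)) (t : L → Strategy I J J) : ℝ :=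
  payoff G θ (joint a.1 Q) a.2 t - ∑ k, a.1.1 k * x k

/-- The maxmin of the dual game. -/
def dualMaxmin (G : K → L → I → J → ℝ) (θ : ℕ → ℝ) (x : K → ℝ) (Q : K → Simplex L) : ℝ :=
  ⨆ a : Simplex K × (K → Strategy I J I), ⨅ t : L → Strategy I J J, dualPayoff G θ x Q a t

/-- The minmax of the dual game. -/
def dualMinmax (G : K → L → I → J → ℝ) (θ : ℕ → ℝ) (x : K → ℝ) (Q : K → Simplex L) : ℝ :=
  ⨅ t : L → Strategy I J J, ⨆ a : Simplex K × (K → Strategy I J I), dualPayoff G θ x Q a t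

/-- `w` is the value of the dual game `D[G_θ](x, Q)`. -/
def IsDualValue (G : K → L → I → J → ℝ) (θ : ℕ → ℝ) (x : K → ℝ) (Q : K → Simplex L)
    (w : ℝ) : Prop :=
  dualMaxmin G θ x Q = w ∧ dualMinmax G θ x Q = w

/-- `w_θ(x, q)` in the independent case `Q(· | k) = q`. It is the value of the dual game, taken as
its minmax; that it is the maxmin too is part of what is claimed. -/
def indepDualValue (G : K → L → I → J → ℝ) (θ : ℕ → ℝ) (x : K → ℝ) (q : Simplex L) : ℝ :=
  dualMinmax G θ x fun _ => q

end Game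

section FirstStage

variable {K L I J : Type*} [Fintype L] [Fintype J]

/-- The marginal on `J` of `q ⊗ τ`. -/
def marginal (q : Simplex L) (τ : L → Simplex J) (j : J) : ℝ := ∑ l, q.1 l * (τ l).1 j

/-- The conditional probability on `L` given `j` under `q ⊗ τ`; it is set to `q` if `j` has
probability `0`. -/
def beliefAfter (q : Simplex L) (τ : L → Simplex J) (j : J) : Simplex L :=
  if h : 0 < marginal q τ j then
    ⟨fun l => q.1 l * (τ l).1 j / marginal q τ j,
      fun l => div_nonneg (mul_nonneg (q.2.1 l) ((τ l).2.1 j)) h.le, by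
        rw [← Finset.sum_div]
        exact div_self h.ne'⟩
  else q

/-- `G^{k,q}_{iτ}`: the expected first-stage payoff given `k` and `i`. -/
def stagePayoff (G : K → L → I → J → ℝ) (q : Simplex L) (τ : L → Simplex J) (i : I) (k : K) : ℝ :=
  ∑ l, ∑ j, q.1 l * (τ l).1 j * G k l i j

/-- The constraint on `(x_{ij})`: for all `i`,
`∑ⱼ τ̄(j) x_{ij} = (x - θ₁ G^q_{iτ}) / (1 - θ₁)` in `ℝ^K`. -/
def IsFeasible (G : K → L → I → J → ℝ) (θ : ℕ → ℝ) (x : K → ℝ) (q : Simplex L)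
    (τ : L → Simplex J) (X : I → J → K → ℝ) : Prop :=
  ∀ i k, ∑ j, marginal q τ j * X i j k = (x k - θ 0 * stagePayoff G q τ i k) / (1 - θ 0)

end FirstStage

end RepeatedGame

end

open RepeatedGame

/-!
Both claims rest on replacing a behaviour strategy `s` by its realization plan `plan π s`, the
product of its own action probabilities along a history. A history has probability the product of
the two plans (`integral_playMeasure_prefix`), so the payoff is affine in either plan and
continuous in the pair of strategies, for the product topology, in which the strategy spaces are
compact. Mixtures of plans are plans (`exists_plan_eq_mix`, a form of Kuhn's theorem), so Ky Fan's
minimax theorem gives the value (`dualMaxmin_eq_dualMinmax`).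

The recursive formula concerns the minmax only. As player 1 chooses the law of his own type, the
dual value is at most `W` if and only if some strategy of player 2 holds every type `k` of player 1
down to `x k + W` (`Guarantees`, `indepDualValue_le_iff`). For a fixed first stage `τ` of player 2,
let `W` be the least amount guaranteed by a strategy that begins with `τ`; it is attained by
compactness.

* If `(x_{ij})` is feasible, then playing `τ` and afterwards an optimal strategy of the dual game
  at `(x_{ij}, q_j)` guarantees `(1 - θ₁) max_i ∑_j τ̄(j) w(x_{ij}, q_j)`
  (`exists_guarantees_of_isFeasible`).
* Given an optimal strategy that begins with `τ`, let `u_{ij}` be the vector of the best-reply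
  payoffs of the types of player 1 after `(i, j)`, and let `x_{ij} = u_{ij} + d_i`, where `d_i` is
  chosen to make `(x_{ij})` feasible. Type `k` can play `i` and then best replies, so
  `d_i ≥ - W / (1 - θ₁)`, hence `w(x_{ij}, q_j) ≤ W / (1 - θ₁)`
  (`exists_isFeasible_of_guarantees`).

Hence the inner minimum is attained and equals `W / (1 - θ₁)`; minimizing over `τ` amounts to
minimizing over all strategies of player 2.
-/

/-! ### A minimax theorem -/

/-- A finite form of the theorem of the alternative: if the functions `f a` and the points `t` can
be mixed, then a threshold that some `f a` exceeds at each `t`, with `a` in a finite family, is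
exceeded by a mixture of that family at all `t`. -/
theorem exists_forall_le_of_finite_of_mix {A T ι : Type*} [Fintype ι] [Nonempty T] (f : A → T → ℝ)
    (hA : ∀ a b, ∀ r ∈ Set.Icc (0 : ℝ) 1, ∃ c, ∀ t, f c t = (1 - r) * f a t + r * f b t)
    (hT : ∀ t u, ∀ r ∈ Set.Icc (0 : ℝ) 1, ∃ v, ∀ a, f a v = (1 - r) * f a t + r * f a u)
    (e : ι → A) {c : ℝ} (hc : ∀ t, ∃ i, c < f (e i) t) : ∃ a, ∀ t, c ≤ f a t := by
  classical
  -- The vectors that some `t` does not exceed are separated from those that lie below `c`.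
  have hconv : Convex ℝ {z : ι → ℝ | ∃ t, ∀ i, f (e i) t ≤ z i} := by
    rw [convex_iff_forall_pos]
    rintro z ⟨t, ht⟩ z' ⟨u, hu⟩ a b ha hb hab
    obtain ⟨v, hv⟩ := hT t u b ⟨hb.le, by linarith⟩
    refine ⟨v, fun i => ?_⟩
    rw [hv, show 1 - b = a by linarith]
    simp only [Pi.add_apply, Pi.smul_apply, smul_eq_mul]
    gcongr
    exacts [ht i, hu i]
  have hopen : IsOpen {z : ι → ℝ | ∀ i, z i < c} := by
    simp only [Set.ofPred_forall]
    exact isOpen_iInter_of_finite fun i => isOpen_lt (continuous_apply i) continuous_const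
  have hconv' : Convex ℝ {z : ι → ℝ | ∀ i, z i < c} := by
    simp only [Set.ofPred_forall]
    exact convex_iInter fun i => convex_halfSpace_lt (LinearMap.proj (R := ℝ) (φ := fun _ : ι => ℝ) i).isLinear c
  have hdisj : Disjoint {z : ι → ℝ | ∀ i, z i < c} {z : ι → ℝ | ∃ t, ∀ i, f (e i) t ≤ z i} := by
    rw [Set.disjoint_left]
    rintro z hz ⟨t, ht⟩
    obtain ⟨i, hi⟩ := hc t
    linarith [hz i, ht i]
  obtain ⟨φ, u, hlt, hge⟩ := geometric_hahn_banach_open hconv' hopen hconv hdisj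
  have hφ : ∀ z : ι → ℝ, φ z = ∑ i, z i * φ (Pi.single i 1) := fun z => by
    conv_lhs => rw [← Finset.univ_sum_single z]
    rw [map_sum]
    refine Finset.sum_congr rfl fun i _ => ?_
    rw [← smul_eq_mul, ← map_smul, ← Pi.single_smul, smul_eq_mul, mul_one]
  set w : ι → ℝ := fun i => φ (Pi.single i 1) with hw
  obtain ⟨t₀⟩ := ‹Nonempty T›
  have hw0 : ∀ i, 0 ≤ w i := by
    intro i
    by_contra! hneg
    -- Going far up in the direction `i` stays in the second set, but `φ` becomes small.
    set N : ℝ := (|u| + |φ fun i => f (e i) t₀| + 1) / (- w i)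
    have hN : 0 ≤ N := div_nonneg (by positivity) (by linarith)
    have h1 := hge ((fun i => f (e i) t₀) + N • Pi.single i 1) ⟨t₀, fun j => by
      have : 0 ≤ (Pi.single i (1 : ℝ) : ι → ℝ) j := by
        by_cases h : j = i
        · subst h; simp
        · simp [h]
      simp only [Pi.add_apply, Pi.smul_apply, smul_eq_mul]
      nlinarith⟩
    rw [map_add, map_smul, smul_eq_mul] at h1
    have h2 : N * w i = -(|u| + |φ fun i => f (e i) t₀| + 1) := by
      have : w i ≠ 0 := hneg.ne
      simp only [N]
      field_simp
    have h3 : N * φ (Pi.single i 1) = N * w i := rfl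
    linarith [neg_abs_le u, le_abs_self (φ fun i => f (e i) t₀)]
  have hsum : 0 < ∑ i, w i := by
    refine lt_of_le_of_ne (Finset.sum_nonneg fun i _ => hw0 i) fun h0 => ?_
    have hz : ∀ i, w i = 0 := fun i =>
      (Finset.sum_eq_zero_iff_of_nonneg fun i _ => hw0 i).1 h0.symm i (Finset.mem_univ i)
    have hφ0 : ∀ z, φ z = 0 := fun z => by
      rw [hφ]
      exact Finset.sum_eq_zero fun i _ => by
        rw [show φ (Pi.single i 1) = 0 from hz i, mul_zero]
    have h1 := hlt (fun _ => c - 1) fun i => by linarith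
    have h2 := hge (fun i => f (e i) t₀) ⟨t₀, fun i => le_rfl⟩
    rw [hφ0] at h1 h2
    linarith
  have hu : c * ∑ i, w i ≤ u := by
    refine le_of_forall_pos_le_add fun ε hε => ?_
    have h1 := hlt (fun _ => c - ε / ∑ i, w i) fun i => by
      have := div_pos hε hsum
      linarith
    rw [hφ, ← Finset.mul_sum] at h1
    have h2 : (c - ε / ∑ i, w i) * ∑ i, w i = c * ∑ i, w i - ε := by
      field_simp
    have h3 : (c - ε / ∑ i, w i) * ∑ i, w i < u := h1
    linarith
  have hmix : Convex ℝ (Set.range f) := by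
    rw [convex_iff_forall_pos]
    rintro _ ⟨a, rfl⟩ _ ⟨b, rfl⟩ r s hr hs hrs
    obtain ⟨c, hc⟩ := hA a b s ⟨hs.le, by linarith⟩
    exact ⟨c, funext fun t => by
      rw [hc, show 1 - s = r by linarith]
      simp only [Pi.add_apply, Pi.smul_apply, smul_eq_mul]⟩
  obtain ⟨a, ha⟩ := hmix.sum_mem (t := Finset.univ) (w := fun i => w i / ∑ i, w i)
    (fun i _ => div_nonneg (hw0 i) hsum.le) (by rw [← Finset.sum_div, div_self hsum.ne'])
    (fun i _ => Set.mem_range_self (e i))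
  refine ⟨a, fun t => ?_⟩
  have h1 := hge (fun i => f (e i) t) ⟨t, fun i => le_rfl⟩
  rw [hφ] at h1
  have h2 : f a t = (∑ i, f (e i) t * w i) / ∑ i, w i := by
    rw [ha, Finset.sum_div, Finset.sum_apply]
    refine Finset.sum_congr rfl fun i _ => ?_
    simp only [Pi.smul_apply, smul_eq_mul]
    ring
  rw [h2, le_div_iff₀ hsum]
  exact hu.trans h1

/-- Ky Fan's minimax theorem for a payoff function that is affine in the following sense: any two
elements of either player can be mixed, with any weights, into a third one. -/
theorem iSup_iInf_eq_iInf_iSup_of_mix {A T : Type*} [Nonempty A] [Nonempty T] [TopologicalSpace T]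
    [CompactSpace T] (f : A → T → ℝ) {C : ℝ} (hC : ∀ a t, |f a t| ≤ C)
    (hf : ∀ a, Continuous (f a))
    (hA : ∀ a b, ∀ r ∈ Set.Icc (0 : ℝ) 1, ∃ c, ∀ t, f c t = (1 - r) * f a t + r * f b t)
    (hT : ∀ t u, ∀ r ∈ Set.Icc (0 : ℝ) 1, ∃ v, ∀ a, f a v = (1 - r) * f a t + r * f a u) :
    ⨆ a, ⨅ t, f a t = ⨅ t, ⨆ a, f a t := by
  have hle : ∀ a t, f a t ≤ C := fun a t => (abs_le.1 (hC a t)).2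
  have hge : ∀ a t, -C ≤ f a t := fun a t => (abs_le.1 (hC a t)).1
  have bA : ∀ t, BddAbove (Set.range fun a => f a t) := fun t =>
    ⟨C, Set.forall_mem_range.2 fun a => hle a t⟩
  have bT : ∀ a, BddBelow (Set.range fun t => f a t) := fun a =>
    ⟨-C, Set.forall_mem_range.2 fun t => hge a t⟩
  have bAT : BddAbove (Set.range fun a => ⨅ t, f a t) :=
    ⟨C, Set.forall_mem_range.2 fun a =>
      (ciInf_le (bT a) (Classical.arbitrary T)).trans (hle a _)⟩
  have bTA : BddBelow (Set.range fun t => ⨆ a, f a t) :=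
    ⟨-C, Set.forall_mem_range.2 fun t =>
      (hge (Classical.arbitrary A) t).trans (le_ciSup (bA t) _)⟩
  refine le_antisymm (ciSup_le fun a => le_ciInf fun t =>
    (ciInf_le (bT a) t).trans (le_ciSup (bA t) a)) ?_
  refine le_of_forall_lt fun c hc => ?_
  obtain ⟨c', hcc', hc'⟩ := exists_between hc
  have hex : ∀ t, ∃ a, c' < f a t := fun t =>
    exists_lt_of_lt_ciSup (hc'.trans_le (ciInf_le bTA t))
  obtain ⟨F, hF⟩ := isCompact_univ.elim_finite_subcover (fun a => {t | c' < f a t})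
    (fun a => isOpen_lt continuous_const (hf a)) fun t _ => by
      obtain ⟨a, ha⟩ := hex t
      exact Set.mem_iUnion.2 ⟨a, ha⟩
  obtain ⟨a, ha⟩ := exists_forall_le_of_finite_of_mix f hA hT (fun a : F => (a : A))
    fun t => by
      obtain ⟨a, haF, ha⟩ := Set.mem_iUnion₂.1 (hF (Set.mem_univ t))
      exact ⟨⟨a, haF⟩, ha⟩
  exact hcc'.trans_le ((le_ciInf ha).trans (le_ciSup bAT a))

/-! ### Realization plans and the law of finite histories -/

/-- The realization plan of a strategy `s`: the product of the probabilities with which `s` takes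
its own actions along a history. The projection `π` reads off the own action from an element of a
history. -/
noncomputable def plan {H A : Type*} [Fintype A] (π : H → A) (s : List H → Simplex A) : List H → ℝ
  | [] => 1
  | a :: h => (s []).1 (π a) * plan π (fun h' => s (a :: h')) h

section Plan

variable {H A : Type*} [Fintype A] (π : H → A)

lemma plan_nonneg (s : List H → Simplex A) (h : List H) : 0 ≤ plan π s h := by
  induction h generalizing s with
  | nil => exact zero_le_one
  | cons a h ih => exact mul_nonneg ((s []).2.1 _) (ih _)

lemma plan_concat (s : List H → Simplex A) (h : List H) (a : H) :
    plan π s (h ++ [a]) = plan π s h * (s h).1 (π a) := by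
  induction h generalizing s with
  | nil => simp [plan]
  | cons b h ih => simp [plan, ih, mul_assoc]

lemma continuous_plan (h : List H) : Continuous fun s : List H → Simplex A => plan π s h := by
  induction h with
  | nil => exact continuous_const
  | cons a h ih =>
    refine Continuous.mul ?_ (ih.comp (continuous_pi fun h' => continuous_apply (a :: h')))
    exact (continuous_apply (π a)).comp (continuous_subtype_val.comp (continuous_apply []))

/-- Kuhn's theorem for two strategies: their mixture is equivalent to a behaviour strategy. -/
theorem exists_plan_eq_mix (s u : List H → Simplex A) {r : ℝ} (hr : r ∈ Set.Icc (0 : ℝ) 1) :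
    ∃ v, ∀ h, plan π v h = (1 - r) * plan π s h + r * plan π u h := by
  classical
  obtain ⟨hr0, hr1⟩ := hr
  set M : List H → ℝ := fun h => (1 - r) * plan π s h + r * plan π u h with hM
  have hs0 : ∀ h, 0 ≤ (1 - r) * plan π s h := fun h =>
    mul_nonneg (by linarith) (plan_nonneg π s h)
  have hu0 : ∀ h, 0 ≤ r * plan π u h := fun h => mul_nonneg hr0 (plan_nonneg π u h)
  -- After `h`, the mixture plays its conditional law given that `h` has been played.
  let v : List H → Simplex A := fun h =>
    if hpos : 0 < M h then
      ⟨fun a => ((1 - r) * plan π s h * (s h).1 a + r * plan π u h * (u h).1 a) / M h,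
        fun a => div_nonneg (add_nonneg (mul_nonneg (hs0 h) ((s h).2.1 a))
          (mul_nonneg (hu0 h) ((u h).2.1 a))) hpos.le, by
          rw [← Finset.sum_div, Finset.sum_add_distrib, ← Finset.mul_sum, ← Finset.mul_sum,
            (s h).2.2, (u h).2.2, mul_one, mul_one]
          exact div_self hpos.ne'⟩
    else s h
  have hv : ∀ h a, M h * (v h).1 a =
      (1 - r) * plan π s h * (s h).1 a + r * plan π u h * (u h).1 a := by
    intro h a
    by_cases hpos : 0 < M h
    · simp only [v, dif_pos hpos]
      exact mul_div_cancel₀ _ hpos.ne'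
    · have h1 : (1 - r) * plan π s h = 0 := le_antisymm (by linarith [hu0 h, not_lt.1 hpos]) (hs0 h)
      have h2 : r * plan π u h = 0 := le_antisymm (by linarith [hs0 h, not_lt.1 hpos]) (hu0 h)
      have h3 : M h = 0 := by simp only [hM, h1, h2, add_zero]
      rw [h1, h2, h3]
      ring
  refine ⟨v, fun h => ?_⟩
  induction h using List.reverseRecOn with
  | nil => simp [plan]
  | append_singleton h a ih =>
    rw [plan_concat, plan_concat, plan_concat, ih]
    have := hv h (π a)
    simp only [hM] at this
    rw [this]
    ring

end Plan

section Law

variable {I J : Type*} [Fintype I] [Fintype J]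

/-- The probability of the history `h` under the strategies `s` and `t`. -/
noncomputable def histProb (s : Strategy I J I) (t : Strategy I J J) (h : List (I × J)) : ℝ :=
  plan Prod.fst s h * plan Prod.snd t h

lemma histProb_nonneg (s : Strategy I J I) (t : Strategy I J J) (h : List (I × J)) :
    0 ≤ histProb s t h :=
  mul_nonneg (plan_nonneg _ _ _) (plan_nonneg _ _ _)

lemma histProb_concat (s : Strategy I J I) (t : Strategy I J J) (h : List (I × J)) (a : I × J) :
    histProb s t (h ++ [a]) = histProb s t h * ((s h).1 a.1 * (t h).1 a.2) := by
  simp only [histProb, plan_concat]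
  ring

lemma histProb_cons (s : Strategy I J I) (t : Strategy I J J) (a : I × J) (h : List (I × J)) :
    histProb s t (a :: h) = (s []).1 a.1 * (t []).1 a.2 *
      histProb (fun h' => s (a :: h')) (fun h' => t (a :: h')) h := by
  simp only [histProb, plan]
  ring

variable [MeasurableSpace I] [DiscreteMeasurableSpace I]
  [MeasurableSpace J] [DiscreteMeasurableSpace J]

lemma integral_toMeasure {X : Type*} [Fintype X] [MeasurableSpace X] [DiscreteMeasurableSpace X]
    (a : Simplex X) (g : X → ℝ) : ∫ x, g x ∂a.toMeasure = ∑ x, a.1 x * g x := by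
  unfold Simplex.toMeasure
  rw [integral_finsetSum_measure fun x _ =>
    (integrable_dirac (by simp)).smul_measure ENNReal.ofReal_ne_top]
  refine Finset.sum_congr rfl fun x _ => ?_
  rw [integral_smul_measure, integral_dirac, ENNReal.toReal_ofReal (a.2.1 x), smul_eq_mul]

lemma integral_stageLaw (s : Strategy I J I) (t : Strategy I J J) (h : List (I × J))
    (g : I × J → ℝ) :
    ∫ y, g y ∂(stageLaw s t h) = ∑ y : I × J, (s h).1 y.1 * (t h).1 y.2 * g y := by
  unfold stageLaw
  rw [integral_prod _ Integrable.of_finite, Fintype.sum_prod_type]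
  simp_rw [integral_toMeasure, Finset.mul_sum, mul_assoc]

lemma map_apply_zero_playMeasure (s : Strategy I J I) (t : Strategy I J J) :
    (playMeasure s t).map (fun ω => ω 0) = stageLaw s t [] := by
  have h : (fun ω : ℕ → I × J => ω 0) =
      (fun y : (m : Finset.Iic 0) → I × J => y ⟨0, Finset.mem_Iic.2 le_rfl⟩) ∘
        Preorder.frestrictLe (π := fun _ => I × J) 0 := rfl
  rw [h, ← Measure.map_map (by fun_prop) (by fun_prop), playMeasure, Kernel.trajMeasure,
    Measure.map_comp _ _ (by fun_prop), Kernel.traj_map_frestrictLe, Kernel.partialTraj_self,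
    Measure.id_comp, Measure.map_map (by fun_prop) (by fun_prop)]
  exact Measure.map_id

/-- The law of the actions of the first `n + 1` stages. -/
theorem integral_playMeasure_prefix (s : Strategy I J I) (t : Strategy I J J) (n : ℕ)
    (f : (Fin (n + 1) → I × J) → ℝ) :
    ∫ ω, f (fun m => ω m) ∂(playMeasure s t) =
      ∑ h : Fin (n + 1) → I × J, histProb s t (List.ofFn h) * f h := by
  induction n with
  | zero =>
    have h1 := integral_map (μ := playMeasure s t) (φ := fun ω => ω 0)
      (f := fun y : I × J => f fun _ => y) (measurable_pi_apply 0).aemeasurable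
      (measurable_of_countable _).aestronglyMeasurable
    rw [map_apply_zero_playMeasure, integral_stageLaw] at h1
    have h2 : ∀ ω : ℕ → I × J, (fun m : Fin (0 + 1) => ω m) = fun _ => ω 0 := fun ω =>
      funext fun m => by rw [Fin.eq_zero m]; rfl
    simp_rw [h2]
    rw [← h1]
    refine Fintype.sum_equiv (Equiv.funUnique (Fin 1) (I × J)).symm _ _ fun y => ?_
    have h3 : (Equiv.funUnique (Fin 1) (I × J)).symm y = fun _ => y := rfl
    rw [h3]
    simp [histProb, plan]
  | succ n ih =>
    have hκ := Kernel.map_frestrictLe_trajMeasure_compProd_eq_map_trajMeasure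
      (X := fun _ => I × J) (μ₀ := stageLaw s t []) (κ := stageKernel s t) (a := n)
    let F : ((m : Finset.Iic n) → I × J) × (I × J) → ℝ := fun z =>
      f (Fin.snoc (α := fun _ => I × J)
        (fun m : Fin (n + 1) => z.1 ⟨m, Finset.mem_Iic.2 (Nat.lt_succ_iff.1 m.isLt)⟩) z.2)
    have hF : Measurable F := measurable_of_countable _
    have h1 : ∫ ω, f (fun m => ω m) ∂(playMeasure s t) =
        ∫ z, F z ∂((playMeasure s t).map fun ω => (Preorder.frestrictLe n ω, ω (n + 1))) := by
      rw [integral_map (by fun_prop) hF.aestronglyMeasurable]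
      refine integral_congr_ae (Filter.Eventually.of_forall fun ω => ?_)
      simp only [F]
      congr 1
      funext m
      refine Fin.lastCases ?_ (fun m => ?_) m
      · simp
      · simp
    have : IsProbabilityMeasure (playMeasure s t) := by unfold playMeasure; infer_instance
    rw [h1]
    unfold playMeasure at *
    rw [← hκ, Measure.integral_compProd Integrable.of_finite,
      integral_map (by fun_prop) (measurable_of_countable _).aestronglyMeasurable]
    have h2 : ∀ ω : ℕ → I × J,
        ∫ y, F (Preorder.frestrictLe n ω, y) ∂(stageKernel s t n (Preorder.frestrictLe n ω)) =
        (fun h : Fin (n + 1) → I × J => ∑ y : I × J, (s (List.ofFn h)).1 y.1 *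
          (t (List.ofFn h)).1 y.2 * f (Fin.snoc (α := fun _ => I × J) h y)) fun m => ω m :=
      fun ω => integral_stageLaw s t _ _
    simp_rw [h2]
    refine (ih fun h => ∑ y : I × J, (s (List.ofFn h)).1 y.1 * (t (List.ofFn h)).1 y.2 *
      f (Fin.snoc (α := fun _ => I × J) h y)).trans ?_
    rw [← Fintype.sum_equiv (Fin.snocEquiv fun _ : Fin (n + 2) => I × J)
      (fun z => histProb s t (List.ofFn (Fin.snoc (α := fun _ => I × J) z.2 z.1)) *
        f (Fin.snoc (α := fun _ => I × J) z.2 z.1)) _ fun z => rfl,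
      Fintype.sum_prod_type, Finset.sum_comm]
    refine Finset.sum_congr rfl fun h _ => ?_
    rw [Finset.mul_sum]
    refine Finset.sum_congr rfl fun y _ => ?_
    have h3 : List.ofFn (Fin.snoc (α := fun _ => I × J) h y) = List.ofFn h ++ [y] := by
      rw [List.ofFn_succ_last, Fin.snoc_last]
      congr 2
      exact funext fun i => Fin.snoc_castSucc (α := fun _ => I × J) y h i
    rw [h3, histProb_concat]
    ring

end Law

/-! ### The payoff of a pair of types -/

section TypePayoff

variable {I J : Type*} [Fintype I] [Fintype J]

/-- The expectation of `g (i, j)` for the actions `(i, j)` of stage `m` (stages are counted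
from `0`). -/
noncomputable def stageExp (g : I → J → ℝ) (s : Strategy I J I) (t : Strategy I J J) (m : ℕ) : ℝ :=
  ∑ h : Fin (m + 1) → I × J,
    histProb s t (List.ofFn h) * g (h (Fin.last m)).1 (h (Fin.last m)).2

/-- The expected `θ`-weighted payoff for the stage payoff `g`. -/
noncomputable def typePayoff (g : I → J → ℝ) (θ : ℕ → ℝ) (s : Strategy I J I)
    (t : Strategy I J J) : ℝ :=
  ∑' m, θ m * stageExp g s t m

lemma stageExp_zero (g : I → J → ℝ) (s : Strategy I J I) (t : Strategy I J J) :
    stageExp g s t 0 = ∑ i, ∑ j, (s []).1 i * (t []).1 j * g i j := by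
  unfold stageExp
  rw [← Fintype.sum_prod_type' (f := fun i j => (s []).1 i * (t []).1 j * g i j)]
  refine Fintype.sum_equiv (Equiv.funUnique (Fin 1) (I × J)) _ _ fun h => ?_
  simp [histProb, plan]

lemma stageExp_succ (g : I → J → ℝ) (s : Strategy I J I) (t : Strategy I J J) (m : ℕ) :
    stageExp g s t (m + 1) = ∑ i, ∑ j, (s []).1 i * (t []).1 j *
      stageExp g (fun h => s ((i, j) :: h)) (fun h => t ((i, j) :: h)) m := by
  unfold stageExp
  rw [← Fintype.sum_prod_type' (f := fun i j => (s []).1 i * (t []).1 j *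
      ∑ h : Fin (m + 1) → I × J, histProb (fun h => s ((i, j) :: h)) (fun h => t ((i, j) :: h))
        (List.ofFn h) * g (h (Fin.last m)).1 (h (Fin.last m)).2),
    ← Fintype.sum_equiv (Fin.consEquiv fun _ : Fin (m + 2) => I × J)
      (fun z => histProb s t (List.ofFn (Fin.cons (α := fun _ => I × J) z.1 z.2)) *
        g (z.2 (Fin.last m)).1 (z.2 (Fin.last m)).2) _ fun z => rfl, Fintype.sum_prod_type]
  refine Finset.sum_congr rfl fun a _ => ?_
  rw [Finset.mul_sum]
  refine Finset.sum_congr rfl fun h _ => ?_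
  rw [List.ofFn_cons, histProb_cons, mul_assoc]

lemma sum_histProb (s : Strategy I J I) (t : Strategy I J J) (m : ℕ) :
    ∑ h : Fin (m + 1) → I × J, histProb s t (List.ofFn h) = 1 := by
  suffices h : stageExp (fun _ _ => 1) s t m = 1 by simpa [stageExp] using h
  induction m generalizing s t with
  | zero =>
    rw [stageExp_zero]
    simp_rw [mul_one, ← Finset.mul_sum, (t []).2.2, mul_one, (s []).2.2]
  | succ m ih =>
    rw [stageExp_succ]
    simp_rw [ih, mul_one, ← Finset.mul_sum, (t []).2.2, mul_one, (s []).2.2]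

lemma abs_le_sum_abs (g : I → J → ℝ) (i : I) (j : J) : |g i j| ≤ ∑ i, ∑ j, |g i j| :=
  (Finset.single_le_sum (f := fun j => |g i j|) (fun _ _ => abs_nonneg _)
    (Finset.mem_univ j)).trans
    (Finset.single_le_sum (f := fun i => ∑ j, |g i j|)
      (fun _ _ => Finset.sum_nonneg fun _ _ => abs_nonneg _) (Finset.mem_univ i))

lemma abs_stageExp_le (g : I → J → ℝ) (s : Strategy I J I) (t : Strategy I J J) (m : ℕ) :
    |stageExp g s t m| ≤ ∑ i, ∑ j, |g i j| := by
  calc |stageExp g s t m|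
      ≤ ∑ h : Fin (m + 1) → I × J, histProb s t (List.ofFn h) * ∑ i, ∑ j, |g i j| := by
        refine (Finset.abs_sum_le_sum_abs _ _).trans (Finset.sum_le_sum fun h _ => ?_)
        rw [abs_mul, abs_of_nonneg (histProb_nonneg _ _ _)]
        exact mul_le_mul_of_nonneg_left (abs_le_sum_abs g _ _) (histProb_nonneg _ _ _)
    _ = _ := by rw [← Finset.sum_mul, sum_histProb, one_mul]

lemma norm_mul_stageExp_le {θ : ℕ → ℝ} (hθ : IsEvaluation θ) (g : I → J → ℝ)
    (s : Strategy I J I) (t : Strategy I J J) (m : ℕ) :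
    ‖θ m * stageExp g s t m‖ ≤ θ m * ∑ i, ∑ j, |g i j| := by
  rw [norm_mul, Real.norm_eq_abs, Real.norm_eq_abs, abs_of_nonneg (hθ.nonneg m)]
  exact mul_le_mul_of_nonneg_left (abs_stageExp_le g s t m) (hθ.nonneg m)

lemma summable_mul_stageExp {θ : ℕ → ℝ} (hθ : IsEvaluation θ) (g : I → J → ℝ)
    (s : Strategy I J I) (t : Strategy I J J) : Summable fun m => θ m * stageExp g s t m :=
  Summable.of_norm_bounded (hθ.hasSum.summable.mul_right _) (norm_mul_stageExp_le hθ g s t)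

lemma continuous_typePayoff {θ : ℕ → ℝ} (hθ : IsEvaluation θ) (g : I → J → ℝ) :
    Continuous fun z : Strategy I J I × Strategy I J J => typePayoff g θ z.1 z.2 := by
  refine continuous_tsum (fun m => ?_) (hθ.hasSum.summable.mul_right _)
    fun m z => norm_mul_stageExp_le hθ g z.1 z.2 m
  refine continuous_const.mul (continuous_finsetSum _ fun h _ => Continuous.mul ?_ continuous_const)
  exact ((continuous_plan _ _).comp continuous_fst).mul ((continuous_plan _ _).comp continuous_snd)

lemma typePayoff_mix_left {θ : ℕ → ℝ} (hθ : IsEvaluation θ) (g : I → J → ℝ)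
    {s s' s'' : Strategy I J I} {c₁ c₂ c₃ : ℝ}
    (h : ∀ h, c₁ * plan Prod.fst s h = c₂ * plan Prod.fst s' h + c₃ * plan Prod.fst s'' h)
    (t : Strategy I J J) :
    c₁ * typePayoff g θ s t = c₂ * typePayoff g θ s' t + c₃ * typePayoff g θ s'' t := by
  unfold typePayoff
  rw [← tsum_mul_left, ← tsum_mul_left, ← tsum_mul_left,
    ← ((summable_mul_stageExp hθ g s' t).mul_left c₂).tsum_add
      ((summable_mul_stageExp hθ g s'' t).mul_left c₃)]
  refine tsum_congr fun m => ?_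
  simp only [stageExp, Finset.mul_sum]
  rw [← Finset.sum_add_distrib]
  refine Finset.sum_congr rfl fun w _ => ?_
  simp only [histProb]
  linear_combination (θ m * plan Prod.snd t (List.ofFn w) *
    g (w (Fin.last m)).1 (w (Fin.last m)).2) * h (List.ofFn w)

lemma typePayoff_mix_right {θ : ℕ → ℝ} (hθ : IsEvaluation θ) (g : I → J → ℝ)
    {t t' t'' : Strategy I J J} {r : ℝ}
    (h : ∀ h, plan Prod.snd t h = (1 - r) * plan Prod.snd t' h + r * plan Prod.snd t'' h)
    (s : Strategy I J I) :
    typePayoff g θ s t = (1 - r) * typePayoff g θ s t' + r * typePayoff g θ s t'' := by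
  unfold typePayoff
  rw [← tsum_mul_left, ← tsum_mul_left,
    ← ((summable_mul_stageExp hθ g s t').mul_left (1 - r)).tsum_add
      ((summable_mul_stageExp hθ g s t'').mul_left r)]
  refine tsum_congr fun m => ?_
  simp only [stageExp, Finset.mul_sum]
  rw [← Finset.sum_add_distrib]
  refine Finset.sum_congr rfl fun w _ => ?_
  simp only [histProb]
  linear_combination (θ m * plan Prod.fst s (List.ofFn w) *
    g (w (Fin.last m)).1 (w (Fin.last m)).2) * h (List.ofFn w)

lemma isEvaluation_nextEval {θ : ℕ → ℝ} (hθ : IsEvaluation θ) (h1 : θ 0 < 1) :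
    IsEvaluation (nextEval θ) := by
  refine ⟨fun m => div_nonneg (hθ.nonneg _) (by linarith), ?_⟩
  have h := ((hasSum_nat_add_iff' 1).2 hθ.hasSum).div_const (1 - θ 0)
  rwa [Finset.sum_range_one, div_self (by linarith)] at h

/-- The payoff splits into that of the first stage and that of the later ones. -/
theorem typePayoff_eq_first_add {θ : ℕ → ℝ} (hθ : IsEvaluation θ) (h1 : θ 0 < 1) (g : I → J → ℝ)
    (s : Strategy I J I) (t : Strategy I J J) :
    typePayoff g θ s t = ∑ i, ∑ j, (s []).1 i * (t []).1 j * (θ 0 * g i j + (1 - θ 0) *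
      typePayoff g (nextEval θ) (fun h => s ((i, j) :: h)) (fun h => t ((i, j) :: h))) := by
  have hne : 1 - θ 0 ≠ 0 := by linarith
  have hsum := fun i j => summable_mul_stageExp (isEvaluation_nextEval hθ h1) g
    (fun h => s ((i, j) :: h)) (fun h => t ((i, j) :: h))
  unfold typePayoff
  rw [(summable_mul_stageExp hθ g s t).tsum_eq_zero_add, stageExp_zero]
  have h2 : ∀ m, θ (m + 1) * stageExp g s t (m + 1) = ∑ i, ∑ j, (s []).1 i * (t []).1 j *
      ((1 - θ 0) * (nextEval θ m *
        stageExp g (fun h => s ((i, j) :: h)) (fun h => t ((i, j) :: h)) m)) := fun m => by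
    rw [stageExp_succ]
    simp only [Finset.mul_sum]
    refine Finset.sum_congr rfl fun i _ => Finset.sum_congr rfl fun j _ => ?_
    have h3 : θ (m + 1) = (1 - θ 0) * nextEval θ m := (mul_div_cancel₀ _ hne).symm
    rw [h3]
    ring
  simp_rw [h2]
  rw [Summable.tsum_finsetSum fun i _ => summable_sum fun j _ =>
    ((hsum i j).mul_left _).mul_left _]
  simp_rw [fun i => Summable.tsum_finsetSum (s := Finset.univ) fun j _ =>
    ((hsum i j).mul_left (1 - θ 0)).mul_left ((s []).1 i * (t []).1 j), tsum_mul_left]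
  rw [Finset.mul_sum, ← Finset.sum_add_distrib]
  refine Finset.sum_congr rfl fun i _ => ?_
  rw [Finset.mul_sum, ← Finset.sum_add_distrib]
  refine Finset.sum_congr rfl fun j _ => ?_
  ring

variable [MeasurableSpace I] [DiscreteMeasurableSpace I]
  [MeasurableSpace J] [DiscreteMeasurableSpace J]

theorem integral_playMeasure_eq_typePayoff {θ : ℕ → ℝ} (hθ : IsEvaluation θ) (g : I → J → ℝ)
    (s : Strategy I J I) (t : Strategy I J J) :
    ∫ ω, ∑' m, θ m * g (ω m).1 (ω m).2 ∂(playMeasure s t) = typePayoff g θ s t := by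
  have : IsProbabilityMeasure (playMeasure s t) := by unfold playMeasure; infer_instance
  have hmeas : ∀ m, Measurable fun ω : ℕ → I × J => θ m * g (ω m).1 (ω m).2 := fun m =>
    (measurable_of_countable fun y : I × J => θ m * g y.1 y.2).comp (measurable_pi_apply m)
  have hbd : ∀ m, ∀ ω : ℕ → I × J, ‖θ m * g (ω m).1 (ω m).2‖ ≤ θ m * ∑ i, ∑ j, |g i j| :=
    fun m ω => by
      rw [norm_mul, Real.norm_eq_abs, Real.norm_eq_abs, abs_of_nonneg (hθ.nonneg m)]
      exact mul_le_mul_of_nonneg_left (abs_le_sum_abs g _ _) (hθ.nonneg m)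
  have hint : ∀ m, Integrable (fun ω : ℕ → I × J => θ m * g (ω m).1 (ω m).2) (playMeasure s t) :=
    fun m => Integrable.of_bound (hmeas m).aestronglyMeasurable _
      (Filter.Eventually.of_forall (hbd m))
  rw [← integral_tsum_of_summable_integral_norm hint]
  · refine tsum_congr fun m => ?_
    rw [integral_const_mul]
    exact congrArg _ (integral_playMeasure_prefix s t m
      fun h => g (h (Fin.last m)).1 (h (Fin.last m)).2)
  · refine Summable.of_nonneg_of_le (fun m => integral_nonneg fun ω => norm_nonneg _) (fun m => ?_)
      (hθ.hasSum.summable.mul_right (∑ i, ∑ j, |g i j|))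
    refine (integral_mono (hint m).norm (integrable_const _) (hbd m)).trans ?_
    simp

end TypePayoff

/-! ### The dual game: continuity, mixing and value -/

section DualGame

variable {K L I J : Type*} [Fintype L] [Fintype I] [Fintype J]

instance Simplex.compactSpace {X : Type*} [Fintype X] : CompactSpace (Simplex X) :=
  isCompact_iff_compactSpace.1 (isCompact_stdSimplex ℝ X)

/-- The probability that is concentrated on `a`. -/
noncomputable def Simplex.pure {X : Type*} [Fintype X] [DecidableEq X] (a : X) : Simplex X :=
  ⟨Pi.single a 1, single_mem_stdSimplex ℝ a⟩

lemma Simplex.sum_pure_mul {X : Type*} [Fintype X] [DecidableEq X] (a : X) (f : X → ℝ) :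
    ∑ x, (Simplex.pure a).1 x * f x = f a := by
  simp [Simplex.pure, Pi.single_apply]

lemma Simplex.sum_mul_le {X : Type*} [Fintype X] (a : Simplex X) {f : X → ℝ} {c : ℝ}
    (h : ∀ x, f x ≤ c) : ∑ x, a.1 x * f x ≤ c := by
  calc ∑ x, a.1 x * f x ≤ ∑ x, a.1 x * c :=
        Finset.sum_le_sum fun x _ => mul_le_mul_of_nonneg_left (h x) (a.2.1 x)
    _ = c := by rw [← Finset.sum_mul, a.2.2, one_mul]

instance Simplex.instNonempty {X : Type*} [Fintype X] [Nonempty X] : Nonempty (Simplex X) := by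
  classical exact ⟨Simplex.pure (Classical.arbitrary X)⟩

/-- The expected payoff when player 1 has type `k` and uses `s`, and the type of player 2 has
law `q`. -/
noncomputable def vectorPayoff (G : K → L → I → J → ℝ) (θ : ℕ → ℝ) (q : Simplex L) (k : K)
    (s : Strategy I J I) (t : L → Strategy I J J) : ℝ :=
  ∑ l, q.1 l * typePayoff (G k l) θ s (t l)

lemma Continuous.vectorPayoff {Z : Type*} [TopologicalSpace Z] (G : K → L → I → J → ℝ)
    {θ : ℕ → ℝ} (hθ : IsEvaluation θ) (q : Simplex L) (k : K) {f : Z → Strategy I J I}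
    {g : Z → L → Strategy I J J} (hf : Continuous f) (hg : Continuous g) :
    Continuous fun z => vectorPayoff G θ q k (f z) (g z) := by
  refine continuous_finsetSum _ fun l _ => continuous_const.mul ?_
  have h : Continuous fun z => (f z, g z l) := hf.prodMk ((continuous_apply l).comp hg)
  exact (continuous_typePayoff hθ (G k l)).comp h

/-- The strategy `t` of player 2 guarantees `W` in the dual game at `(x, q)`: against every type
`k` of player 1, it brings the payoff down to `x k + W`. -/
def Guarantees (G : K → L → I → J → ℝ) (θ : ℕ → ℝ) (x : K → ℝ) (q : Simplex L)
    (t : L → Strategy I J J) (W : ℝ) : Prop :=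
  ∀ k s, vectorPayoff G θ q k s t ≤ x k + W

variable [Fintype K] [MeasurableSpace I] [DiscreteMeasurableSpace I]
  [MeasurableSpace J] [DiscreteMeasurableSpace J]

lemma dualPayoff_eq (G : K → L → I → J → ℝ) {θ : ℕ → ℝ} (hθ : IsEvaluation θ) (x : K → ℝ)
    (q : Simplex L) (a : Simplex K × (K → Strategy I J I)) (t : L → Strategy I J J) :
    dualPayoff G θ x (fun _ => q) a t =
      ∑ k, a.1.1 k * (vectorPayoff G θ q k (a.2 k) t - x k) := by
  unfold dualPayoff payoff vectorPayoff
  simp_rw [integral_playMeasure_eq_typePayoff hθ, joint, mul_sub, Finset.mul_sum,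
    Finset.sum_sub_distrib, mul_assoc]

lemma Continuous.dualPayoff {Z : Type*} [TopologicalSpace Z] (G : K → L → I → J → ℝ) {θ : ℕ → ℝ}
    (hθ : IsEvaluation θ) (x : K → ℝ) (q : Simplex L)
    {f : Z → Simplex K × (K → Strategy I J I)} {g : Z → L → Strategy I J J}
    (hf : Continuous f) (hg : Continuous g) :
    Continuous fun z => dualPayoff G θ x (fun _ => q) (f z) (g z) := by
  simp_rw [dualPayoff_eq G hθ]
  refine continuous_finsetSum _ fun k _ => Continuous.mul ?_ (Continuous.sub ?_ continuous_const)
  · have h : Continuous fun p : Simplex K => p.1 k :=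
      (continuous_apply k).comp continuous_subtype_val
    exact h.comp (continuous_fst.comp hf)
  · have h : Continuous fun z => (f z).2 k := (continuous_apply k).comp (continuous_snd.comp hf)
    exact h.vectorPayoff G hθ q k hg

lemma exists_abs_dualPayoff_le (G : K → L → I → J → ℝ) {θ : ℕ → ℝ} (hθ : IsEvaluation θ)
    (x : K → ℝ) (q : Simplex L) : ∃ C, ∀ a t, |dualPayoff G θ x (fun _ => q) a t| ≤ C := by
  obtain ⟨C, hC⟩ := (isCompact_range
    (continuous_fst.dualPayoff G hθ x q continuous_snd)).isBounded.exists_norm_le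
  exact ⟨C, fun a t => hC _ ⟨(a, t), rfl⟩⟩

lemma bddAbove_dualPayoff (G : K → L → I → J → ℝ) {θ : ℕ → ℝ} (hθ : IsEvaluation θ)
    (x : K → ℝ) (q : Simplex L) (t : L → Strategy I J J) :
    BddAbove (Set.range fun a => dualPayoff G θ x (fun _ => q) a t) := by
  obtain ⟨C, hC⟩ := exists_abs_dualPayoff_le G hθ x q
  exact ⟨C, Set.forall_mem_range.2 fun a => (abs_le.1 (hC a t)).2⟩

lemma exists_dualPayoff_eq_mix_left (G : K → L → I → J → ℝ) {θ : ℕ → ℝ} (hθ : IsEvaluation θ)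
    (x : K → ℝ) (q : Simplex L) (a b : Simplex K × (K → Strategy I J I)) {r : ℝ}
    (hr : r ∈ Set.Icc (0 : ℝ) 1) :
    ∃ c, ∀ t, dualPayoff G θ x (fun _ => q) c t =
      (1 - r) * dualPayoff G θ x (fun _ => q) a t + r * dualPayoff G θ x (fun _ => q) b t := by
  have ha : ∀ k, 0 ≤ (1 - r) * a.1.1 k := fun k => mul_nonneg (by linarith [hr.2]) (a.1.2.1 k)
  have hb : ∀ k, 0 ≤ r * b.1.1 k := fun k => mul_nonneg hr.1 (b.1.2.1 k)
  let p : Simplex K := ⟨fun k => (1 - r) * a.1.1 k + r * b.1.1 k,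
    fun k => add_nonneg (ha k) (hb k), by
      rw [Finset.sum_add_distrib, ← Finset.mul_sum, ← Finset.mul_sum, a.1.2.2, b.1.2.2]
      ring⟩
  -- The plans of type `k` are mixed with the conditional weights given `k`.
  have hs : ∀ k, ∃ s : Strategy I J I, ∀ h, p.1 k * plan Prod.fst s h =
      (1 - r) * a.1.1 k * plan Prod.fst (a.2 k) h + r * b.1.1 k * plan Prod.fst (b.2 k) h := by
    intro k
    have hp : p.1 k = (1 - r) * a.1.1 k + r * b.1.1 k := rfl
    rcases (p.2.1 k).eq_or_lt with h0 | hpos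
    · refine ⟨a.2 k, fun h => ?_⟩
      have h1 : (1 - r) * a.1.1 k = 0 := by linarith [ha k, hb k]
      have h2 : r * b.1.1 k = 0 := by linarith [ha k, hb k]
      rw [hp, h1, h2]
      ring
    · obtain ⟨s, hs⟩ := exists_plan_eq_mix (Prod.fst : I × J → I) (a.2 k) (b.2 k)
        (r := r * b.1.1 k / p.1 k)
        ⟨div_nonneg (hb k) hpos.le, (div_le_one hpos).2 (by linarith [ha k])⟩
      refine ⟨s, fun h => ?_⟩
      rw [hs]
      have := hpos.ne'
      field_simp
      rw [hp]
      ring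
  choose s hs using hs
  refine ⟨(p, s), fun t => ?_⟩
  simp_rw [dualPayoff_eq G hθ, Finset.mul_sum]
  rw [← Finset.sum_add_distrib]
  refine Finset.sum_congr rfl fun k _ => ?_
  have h1 : p.1 k * vectorPayoff G θ q k (s k) t =
      (1 - r) * a.1.1 k * vectorPayoff G θ q k (a.2 k) t +
        r * b.1.1 k * vectorPayoff G θ q k (b.2 k) t := by
    simp only [vectorPayoff, Finset.mul_sum]
    rw [← Finset.sum_add_distrib]
    refine Finset.sum_congr rfl fun l _ => ?_
    linear_combination q.1 l * typePayoff_mix_left hθ (G k l) (hs k) (t l)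
  have h2 : p.1 k = (1 - r) * a.1.1 k + r * b.1.1 k := rfl
  linear_combination h1 - x k * h2

lemma exists_dualPayoff_eq_mix_right (G : K → L → I → J → ℝ) {θ : ℕ → ℝ} (hθ : IsEvaluation θ)
    (x : K → ℝ) (q : Simplex L) (t u : L → Strategy I J J) {r : ℝ}
    (hr : r ∈ Set.Icc (0 : ℝ) 1) :
    ∃ v, ∀ a, dualPayoff G θ x (fun _ => q) a v =
      (1 - r) * dualPayoff G θ x (fun _ => q) a t + r * dualPayoff G θ x (fun _ => q) a u := by
  choose v hv using fun l => exists_plan_eq_mix (Prod.snd : I × J → J) (t l) (u l) hr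
  refine ⟨v, fun a => ?_⟩
  simp_rw [dualPayoff_eq G hθ, Finset.mul_sum]
  rw [← Finset.sum_add_distrib]
  refine Finset.sum_congr rfl fun k _ => ?_
  have h1 : vectorPayoff G θ q k (a.2 k) v = (1 - r) * vectorPayoff G θ q k (a.2 k) t +
      r * vectorPayoff G θ q k (a.2 k) u := by
    simp only [vectorPayoff, Finset.mul_sum]
    rw [← Finset.sum_add_distrib]
    refine Finset.sum_congr rfl fun l _ => ?_
    linear_combination q.1 l * typePayoff_mix_right hθ (G k l) (hv l) (a.2 k)
  rw [h1]
  ring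

/-- The dual game has a value. -/
theorem dualMaxmin_eq_dualMinmax [Nonempty K] [Nonempty I] [Nonempty J]
    (G : K → L → I → J → ℝ) {θ : ℕ → ℝ} (hθ : IsEvaluation θ) (x : K → ℝ) (q : Simplex L) :
    dualMaxmin G θ x (fun _ => q) = dualMinmax G θ x (fun _ => q) := by
  obtain ⟨C, hC⟩ := exists_abs_dualPayoff_le G hθ x q
  unfold dualMaxmin dualMinmax
  exact iSup_iInf_eq_iInf_iSup_of_mix (fun a t => dualPayoff G θ x (fun _ => q) a t) hC
    (fun _ => continuous_const.dualPayoff G hθ x q continuous_id)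
    (fun a b _ hr => exists_dualPayoff_eq_mix_left G hθ x q a b hr)
    (fun t u _ hr => exists_dualPayoff_eq_mix_right G hθ x q t u hr)

lemma iSup_dualPayoff_le_iff [Nonempty K] [Nonempty I] (G : K → L → I → J → ℝ) {θ : ℕ → ℝ}
    (hθ : IsEvaluation θ) (x : K → ℝ) (q : Simplex L) (t : L → Strategy I J J) {W : ℝ} :
    ⨆ a, dualPayoff G θ x (fun _ => q) a t ≤ W ↔ Guarantees G θ x q t W := by
  classical
  refine ⟨fun h k s => ?_, fun h => ciSup_le fun a => ?_⟩
  · have h1 := (le_ciSup (bddAbove_dualPayoff G hθ x q t)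
      ((Simplex.pure k, fun _ => s) : Simplex K × (K → Strategy I J I))).trans h
    simp only [dualPayoff_eq G hθ, Simplex.sum_pure_mul] at h1
    linarith
  · rw [dualPayoff_eq G hθ]
    exact Simplex.sum_mul_le _ fun k => by linarith [h k (a.2 k)]

/-- Over a closed set of strategies of player 2, some strategy guarantees the least amount. -/
lemma exists_isMinOn_iSup_dualPayoff [Nonempty K] [Nonempty I] (G : K → L → I → J → ℝ) {θ : ℕ → ℝ}
    (hθ : IsEvaluation θ) (x : K → ℝ) (q : Simplex L) {S : Set (L → Strategy I J J)}
    (hS : IsClosed S) (hne : S.Nonempty) :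
    ∃ t ∈ S, IsMinOn (fun t => ⨆ a, dualPayoff G θ x (fun _ => q) a t) S t :=
  (lowerSemicontinuous_ciSup (bddAbove_dualPayoff G hθ x q) fun _ =>
    (continuous_const.dualPayoff G hθ x q continuous_id).lowerSemicontinuous).lowerSemicontinuousOn S
    |>.exists_isMinOn hne hS.isCompact

lemma exists_iSup_dualPayoff_eq_indepDualValue [Nonempty K] [Nonempty I] [Nonempty J]
    (G : K → L → I → J → ℝ) {θ : ℕ → ℝ} (hθ : IsEvaluation θ) (x : K → ℝ) (q : Simplex L) :
    ∃ t : L → Strategy I J J, ⨆ a, dualPayoff G θ x (fun _ => q) a t = indepDualValue G θ x q := by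
  obtain ⟨t, -, ht⟩ := exists_isMinOn_iSup_dualPayoff G hθ x q isClosed_univ Set.univ_nonempty
  refine ⟨t, le_antisymm (le_ciInf fun u => ht (Set.mem_univ u)) (ciInf_le ?_ t)⟩
  exact ⟨_, Set.forall_mem_range.2 fun u => ht (Set.mem_univ u)⟩

lemma indepDualValue_le_iff [Nonempty K] [Nonempty I] [Nonempty J] (G : K → L → I → J → ℝ)
    {θ : ℕ → ℝ} (hθ : IsEvaluation θ) (x : K → ℝ) (q : Simplex L) {W : ℝ} :
    indepDualValue G θ x q ≤ W ↔ ∃ t : L → Strategy I J J, Guarantees G θ x q t W := by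
  refine ⟨fun h => ?_, fun ⟨t, ht⟩ => ?_⟩
  · obtain ⟨t, ht⟩ := exists_iSup_dualPayoff_eq_indepDualValue G hθ x q
    exact ⟨t, (iSup_dualPayoff_le_iff G hθ x q t).1 (ht.le.trans h)⟩
  · obtain ⟨u, -, hu⟩ := exists_isMinOn_iSup_dualPayoff G hθ x q isClosed_univ Set.univ_nonempty
    have hb : BddBelow (Set.range fun t : L → Strategy I J J =>
        ⨆ a, dualPayoff G θ x (fun _ => q) a t) :=
      ⟨_, Set.forall_mem_range.2 fun v => hu (Set.mem_univ v)⟩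
    exact (ciInf_le hb t).trans ((iSup_dualPayoff_le_iff G hθ x q t).2 ht)

end DualGame

/-! ### The first stage of the dual game -/

section FirstStage

variable {K L I J : Type*} [Fintype L] [Fintype I] [Fintype J]

lemma marginal_nonneg (q : Simplex L) (τ : L → Simplex J) (j : J) : 0 ≤ marginal q τ j :=
  Finset.sum_nonneg fun l _ => mul_nonneg (q.2.1 l) ((τ l).2.1 j)

lemma sum_marginal (q : Simplex L) (τ : L → Simplex J) : ∑ j, marginal q τ j = 1 := by
  unfold marginal
  rw [Finset.sum_comm]
  simp_rw [← Finset.mul_sum, fun l => (τ l).2.2, mul_one, q.2.2]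

lemma marginal_mul_beliefAfter (q : Simplex L) (τ : L → Simplex J) (j : J) (l : L) :
    marginal q τ j * (beliefAfter q τ j).1 l = q.1 l * (τ l).1 j := by
  unfold beliefAfter
  split_ifs with h
  · exact mul_div_cancel₀ _ h.ne'
  · have h0 : marginal q τ j = 0 := le_antisymm (not_lt.1 h) (marginal_nonneg q τ j)
    rw [h0, zero_mul]
    exact ((Finset.sum_eq_zero_iff_of_nonneg fun l _ =>
      mul_nonneg (q.2.1 l) ((τ l).2.1 j)).1 h0 l (Finset.mem_univ l)).symm

/-- The payoff against type `k` when player 2 plays `τ` at the first stage: an average over the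
first action `i` of player 1 of the first-stage payoff and of the payoffs of the continuation
games, in which the type of player 2 has its conditional law given `j`. -/
theorem vectorPayoff_eq_first_add (G : K → L → I → J → ℝ) {θ : ℕ → ℝ} (hθ : IsEvaluation θ)
    (h1 : θ 0 < 1) (q : Simplex L) (k : K) (s : Strategy I J I) (t : L → Strategy I J J)
    {τ : L → Simplex J} (hτ : ∀ l, t l [] = τ l) :
    vectorPayoff G θ q k s t = ∑ i, (s []).1 i * (θ 0 * stagePayoff G q τ i k + (1 - θ 0) *
      ∑ j, marginal q τ j * vectorPayoff G (nextEval θ) (beliefAfter q τ j) k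
        (fun h => s ((i, j) :: h)) (fun l h => t l ((i, j) :: h))) := by
  simp only [vectorPayoff, stagePayoff, Finset.mul_sum (Finset.univ : Finset L), ← mul_assoc,
    marginal_mul_beliefAfter]
  simp_rw [typePayoff_eq_first_add hθ h1, hτ, Finset.mul_sum]
  rw [Finset.sum_comm]
  refine Finset.sum_congr rfl fun i _ => ?_
  simp only [mul_add, Finset.mul_sum, Finset.sum_add_distrib]
  congr 1
  · exact Finset.sum_congr rfl fun l _ => Finset.sum_congr rfl fun j _ => by ring
  · rw [Finset.sum_comm]
    exact Finset.sum_congr rfl fun l _ => Finset.sum_congr rfl fun j _ => by ring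

variable [Fintype K] [Nonempty K] [Nonempty I] [Nonempty J]
  [MeasurableSpace I] [DiscreteMeasurableSpace I]
  [MeasurableSpace J] [DiscreteMeasurableSpace J]

/-- Player 2 guarantees the right-hand side of the recursive formula by playing `τ` and then, after
`(i, j)`, an optimal strategy of the dual game at `X i j` and the conditional law given `j`. -/
theorem exists_guarantees_of_isFeasible (G : K → L → I → J → ℝ) {θ : ℕ → ℝ} (hθ : IsEvaluation θ)
    (h1 : θ 0 < 1) (x : K → ℝ) (q : Simplex L) (τ : L → Simplex J) {X : I → J → K → ℝ}
    (hX : IsFeasible G θ x q τ X) {r : ℝ}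
    (hr : ∀ i, ∑ j, marginal q τ j *
      indepDualValue G (nextEval θ) (X i j) (beliefAfter q τ j) ≤ r) :
    ∃ t : L → Strategy I J J, (∀ l, t l [] = τ l) ∧ Guarantees G θ x q t ((1 - θ 0) * r) := by
  have hpos : 0 < 1 - θ 0 := by linarith
  choose u hu using fun i j => (indepDualValue_le_iff G (isEvaluation_nextEval hθ h1) (X i j)
    (beliefAfter q τ j)).1 le_rfl
  let t : L → Strategy I J J := fun l h => match h with
    | [] => τ l
    | a :: h' => u a.1 a.2 l h'
  refine ⟨t, fun l => rfl, fun k s => ?_⟩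
  rw [vectorPayoff_eq_first_add G hθ h1 q k s t fun l => rfl]
  refine Simplex.sum_mul_le (s []) fun i => ?_
  have h2 : ∑ j, marginal q τ j * vectorPayoff G (nextEval θ) (beliefAfter q τ j) k
      (fun h => s ((i, j) :: h)) (u i j) ≤
      (x k - θ 0 * stagePayoff G q τ i k) / (1 - θ 0) + r := by
    rw [← hX i k]
    refine le_trans ?_ (add_le_add le_rfl (hr i))
    rw [← Finset.sum_add_distrib]
    refine Finset.sum_le_sum fun j _ => ?_
    rw [← mul_add]
    exact mul_le_mul_of_nonneg_left (hu i j k _) (marginal_nonneg q τ j)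
  have h3 := mul_le_mul_of_nonneg_left h2 hpos.le
  rw [mul_add, mul_div_cancel₀ _ hpos.ne'] at h3
  change θ 0 * stagePayoff G q τ i k + (1 - θ 0) * ∑ j, marginal q τ j *
    vectorPayoff G (nextEval θ) (beliefAfter q τ j) k (fun h => s ((i, j) :: h)) (u i j) ≤ _
  linarith

/-- Conversely, what a strategy with first stage `τ` guarantees bounds the right-hand side of the
recursive formula, for the `X i j` that are, up to translations that do not depend on `j`, the
vectors of best-reply payoffs of the types of player 1 in the continuation games. -/
theorem exists_isFeasible_of_guarantees (G : K → L → I → J → ℝ) {θ : ℕ → ℝ} (hθ : IsEvaluation θ)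
    (h1 : θ 0 < 1) (x : K → ℝ) (q : Simplex L) {τ : L → Simplex J} {t : L → Strategy I J J}
    (hτ : ∀ l, t l [] = τ l) {W : ℝ} (ht : Guarantees G θ x q t W) :
    ∃ X : I → J → K → ℝ, IsFeasible G θ x q τ X ∧
      ∀ i, ∑ j, marginal q τ j *
        indepDualValue G (nextEval θ) (X i j) (beliefAfter q τ j) ≤ W / (1 - θ 0) := by
  classical
  have hpos : 0 < 1 - θ 0 := by linarith
  have hθ' := isEvaluation_nextEval hθ h1
  have hex : ∀ i j k, ∃ s : Strategy I J I, ∀ s' : Strategy I J I,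
      vectorPayoff G (nextEval θ) (beliefAfter q τ j) k s' (fun l h => t l ((i, j) :: h)) ≤
      vectorPayoff G (nextEval θ) (beliefAfter q τ j) k s (fun l h => t l ((i, j) :: h)) := by
    intro i j k
    obtain ⟨s, -, hs⟩ := isCompact_univ.exists_isMaxOn Set.univ_nonempty
      (continuous_id.vectorPayoff G hθ' (beliefAfter q τ j) k
        (continuous_const (y := fun l h => t l ((i, j) :: h)))).continuousOn
    exact ⟨s, fun s' => hs (Set.mem_univ s')⟩
  choose s hs using hex
  set u : I → J → K → ℝ := fun i j k =>
    vectorPayoff G (nextEval θ) (beliefAfter q τ j) k (s i j k) (fun l h => t l ((i, j) :: h))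
    with hu
  set d : I → K → ℝ := fun i k =>
    (x k - θ 0 * stagePayoff G q τ i k) / (1 - θ 0) - ∑ j, marginal q τ j * u i j k with hd
  have hdW : ∀ i k, -(W / (1 - θ 0)) ≤ d i k := by
    intro i k
    -- Type `k` of player 1 plays `i`, then a best reply in each continuation game.
    let σ : Strategy I J I := fun h => match h with
      | [] => Simplex.pure i
      | a :: h' => s a.1 a.2 k h'
    have h2 := ht k σ
    rw [vectorPayoff_eq_first_add G hθ h1 q k σ t hτ] at h2
    have h3 : θ 0 * stagePayoff G q τ i k + (1 - θ 0) * ∑ j, marginal q τ j * u i j k ≤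
        x k + W := (Simplex.sum_pure_mul i _).symm.trans_le h2
    have h4 : d i k + W / (1 - θ 0) = (x k + W - (θ 0 * stagePayoff G q τ i k +
        (1 - θ 0) * ∑ j, marginal q τ j * u i j k)) / (1 - θ 0) := by
      simp only [hd]
      field_simp
      ring
    have h5 : 0 ≤ d i k + W / (1 - θ 0) := h4 ▸ div_nonneg (by linarith) hpos.le
    linarith
  refine ⟨fun i j k => u i j k + d i k, fun i k => ?_, fun i => ?_⟩
  · simp_rw [mul_add]
    rw [Finset.sum_add_distrib, ← Finset.sum_mul, sum_marginal, hd]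
    ring
  · calc ∑ j, marginal q τ j * indepDualValue G (nextEval θ) (fun k => u i j k + d i k)
          (beliefAfter q τ j)
        ≤ ∑ j, marginal q τ j * (W / (1 - θ 0)) := by
          refine Finset.sum_le_sum fun j _ =>
            mul_le_mul_of_nonneg_left ?_ (marginal_nonneg q τ j)
          refine (indepDualValue_le_iff G hθ' _ _).2
            ⟨fun l h => t l ((i, j) :: h), fun k s' => (hs i j k s').trans ?_⟩
          have := hdW i k
          simp only [hu] at this ⊢
          linarith
      _ = W / (1 - θ 0) := by rw [← Finset.sum_mul, sum_marginal, one_mul]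

end FirstStage

/-! ### The recursive formula -/

theorem mainTheorem4 {K L I J : Type*} [Fintype K] [Fintype L] [Fintype I] [Fintype J]
    [Nonempty K] [Nonempty L] [Nonempty I] [Nonempty J]
    [MeasurableSpace I] [DiscreteMeasurableSpace I]
    [MeasurableSpace J] [DiscreteMeasurableSpace J]
    (G : K → L → I → J → ℝ) (θ : ℕ → ℝ) (hθ : IsEvaluation θ) (x : K → ℝ) (q : Simplex L) :
    IsDualValue G θ x (fun _ => q) (indepDualValue G θ x q) ∧
    (θ 0 < 1 →
      ∃ m : (L → Simplex J) → ℝ,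
        (∀ τ : L → Simplex J,
          IsLeast
            {r : ℝ | ∃ X : I → J → K → ℝ, IsFeasible G θ x q τ X ∧
              r = Finset.univ.sup' Finset.univ_nonempty fun i : I =>
                ∑ j, marginal q τ j *
                  indepDualValue G (nextEval θ) (X i j) (beliefAfter q τ j)}
            (m τ)) ∧
        ∃ μ : ℝ, IsLeast (Set.range m) μ ∧ indepDualValue G θ x q = (1 - θ 0) * μ) := by
  refine ⟨⟨dualMaxmin_eq_dualMinmax G hθ x q, rfl⟩, fun h1 => ?_⟩
  have hpos : 0 < 1 - θ 0 := by linarith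
  let F : (L → Strategy I J J) → ℝ := fun t => ⨆ a, dualPayoff G θ x (fun _ => q) a t
  -- For each `τ`, an optimal strategy among those that begin with `τ`.
  have hmin : ∀ τ : L → Simplex J, ∃ t : L → Strategy I J J, (∀ l, t l [] = τ l) ∧
      ∀ u : L → Strategy I J J, (∀ l, u l [] = τ l) → F t ≤ F u := by
    intro τ
    have hcl : IsClosed {t : L → Strategy I J J | ∀ l, t l [] = τ l} := by
      simp only [Set.ofPred_forall]
      exact isClosed_iInter fun l => isClosed_eq
        ((continuous_apply []).comp (continuous_apply l)) continuous_const
    obtain ⟨t, ht, hmin⟩ := exists_isMinOn_iSup_dualPayoff G hθ x q hcl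
      ⟨fun l _ => τ l, fun l => rfl⟩
    exact ⟨t, ht, fun u hu => hmin hu⟩
  choose T hT hTmin using hmin
  have hlow : ∀ (τ : L → Simplex J) (X : I → J → K → ℝ), IsFeasible G θ x q τ X →
      F (T τ) / (1 - θ 0) ≤ Finset.univ.sup' Finset.univ_nonempty fun i : I =>
        ∑ j, marginal q τ j *
          indepDualValue G (nextEval θ) (X i j) (beliefAfter q τ j) := by
    intro τ X hX
    obtain ⟨t, ht, htW⟩ := exists_guarantees_of_isFeasible G hθ h1 x q τ hX
      (r := Finset.univ.sup' Finset.univ_nonempty fun i : I => ∑ j, marginal q τ j *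
        indepDualValue G (nextEval θ) (X i j) (beliefAfter q τ j))
      (fun i => Finset.le_sup' (fun i : I => ∑ j, marginal q τ j *
        indepDualValue G (nextEval θ) (X i j) (beliefAfter q τ j)) (Finset.mem_univ i))
    rw [div_le_iff₀' hpos]
    exact (hTmin τ t ht).trans ((iSup_dualPayoff_le_iff G hθ x q t).2 htW)
  have hge : ∀ τ, indepDualValue G θ x q ≤ F (T τ) := fun τ =>
    (indepDualValue_le_iff G hθ x q).2
      ⟨T τ, (iSup_dualPayoff_le_iff G hθ x q (T τ)).1 le_rfl⟩
  refine ⟨fun τ => F (T τ) / (1 - θ 0), fun τ => ⟨?_, ?_⟩, indepDualValue G θ x q / (1 - θ 0),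
    ⟨?_, ?_⟩, (mul_div_cancel₀ _ hpos.ne').symm⟩
  · obtain ⟨X, hX, hXW⟩ := exists_isFeasible_of_guarantees G hθ h1 x q (hT τ)
      ((iSup_dualPayoff_le_iff G hθ x q (T τ)).1 le_rfl)
    exact ⟨X, hX, le_antisymm (hlow τ X hX) (Finset.sup'_le _ _ fun i _ => hXW i)⟩
  · rintro _ ⟨X, hX, rfl⟩
    exact hlow τ X hX
  · obtain ⟨t, ht⟩ := exists_iSup_dualPayoff_eq_indepDualValue G hθ x q
    have h : F (T fun l => t l []) = indepDualValue G θ x q :=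
      le_antisymm ((hTmin _ t fun l => rfl).trans_eq ht) (hge _)
    exact ⟨fun l => t l [], congrArg (· / (1 - θ 0)) h⟩
  · rintro _ ⟨τ, rfl⟩
    exact div_le_div_of_nonneg_right (hge τ) hpos.le
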